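/- Let $\Gamma\subset\mathbb C$ be a Jordan curve and let $\Omega$ and $\Omega^*$ be the bounded and the unbounded component of $\widehat{\mathbb C}\setminus\Gamma$. Let $A(\Omega)$ be the space of continuous functions on $\overline\Omega$ that are holomorphic in $\Omega$, and let $A(\Omega^*)$ be the space of continuous functions on $\overline{\Omega^*}$ that are holomorphic in $\Omega^*$ and vanish at $\infty$. The curve $\Gamma$ is called MP-solvable if there exist non-constant $f\in A(\Omega)$ and $g\in A(\Omega^*)$ with $f=\overline g$ on $\Gamma$. Let $\mathbb D$ be the open unit disk, $\mathbb T$ the unit circle and $\mathbb D^*=\widehat{\mathbb C}\setminus\overline{\mathbb D}$. Let $F:\mathbb D\to\Omega$ and $G:\mathbb D^*\to\Omega^*$ be conformal bijections with $G(\infty)=\infty$ (with any choice of the remaining normalizations). Denote their homeomorphic extensions to the closures (which exist by Carathéodory's theorem) by the same letters, and let $h_\Gamma:=G^{-1}\circ F:\mathbb T\to\mathbb T$ be the corresponding conformal welding homeomorphism of $\Gamma$. Then $\Gamma$ is MP-solvable if and only if there exist non-constant functions $\varphi,\psi$ in the disk algebra $A(\mathbb D)$ (the continuous functions on $\overline{\mathbb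 D}$ that are holomorphic in $\mathbb D$) such that $\varphi=\psi\circ h_\Gamma$ on $\mathbb T$. -/

import Mathlib

open Set Filter Topology

namespace Matching

/-- A Jordan curve in the plane: the image of the unit circle under a continuous injective map. -/
def IsJordanCurve (Γ : Set ℂ) : Prop :=
  ∃ γ : Circle → ℂ, Continuous γ ∧ Function.Injective γ ∧ range γ = Γ

/-- The bounded complementary component `Ω` of a Jordan curve `Γ`: the points off `Γ` whose
component in the complement of `Γ` is bounded. -/
def inside (Γ : Set ℂ) : Set ℂ :=
  {z | z ∈ Γᶜ ∧ Bornology.IsBounded (connectedComponentIn Γᶜ z)}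

/-- The unbounded complementary component `Ω*` of a Jordan curve `Γ`, without the point at
infinity: the points off `Γ` whose component in the complement of `Γ` is unbounded. -/
def outside (Γ : Set ℂ) : Set ℂ :=
  {z | z ∈ Γᶜ ∧ ¬ Bornology.IsBounded (connectedComponentIn Γᶜ z)}

/-- The open unit disk `𝔻`. -/
def disk : Set ℂ := {z | ‖z‖ < 1}

/-- The exterior `𝔻*` of the closed unit disk, without the point at infinity. -/
def exteriorDisk : Set ℂ := {z | 1 < ‖z‖}

/-- `f` is not constant on `s`. -/
def NonconstantOn (f : ℂ → ℂ) (s : Set ℂ) : Prop :=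
  ∃ x ∈ s, ∃ y ∈ s, f x ≠ f y

/-- `f` restricts to an element of `A(U)`: it is holomorphic in `U` and continuous on the closure
of `U`. For `U = disk` this is the disk algebra. Values off the closure of `U` are irrelevant. -/
def MemA (U : Set ℂ) (f : ℂ → ℂ) : Prop :=
  DifferentiableOn ℂ f U ∧ ContinuousOn f (closure U)

/-- `g` restricts to an element of `A(Ω*)`, where `Ω* = U ∪ {∞}`, that vanishes at infinity. By the
removable singularity theorem a function which is holomorphic in `U` and tends to `0` at infinity
is holomorphic in `U ∪ {∞}` when it is given the value `0` at infinity. -/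
def MemAInfty (U : Set ℂ) (g : ℂ → ℂ) : Prop :=
  MemA U g ∧ Tendsto g (Bornology.cobounded ℂ) (𝓝 0)

/-- `f` and `g` form a matching pair for `Γ`. -/
def IsMatchingPair (Γ : Set ℂ) (f g : ℂ → ℂ) : Prop :=
  MemA (inside Γ) f ∧ MemAInfty (outside Γ) g ∧
    NonconstantOn f (closure (inside Γ)) ∧ NonconstantOn g (closure (outside Γ)) ∧
    ∀ z ∈ Γ, f z = starRingEnd ℂ (g z)

/-- `Γ` is MP-solvable: the matching problem for `Γ` has a solution. -/
def MPSolvable (Γ : Set ℂ) : Prop :=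
  ∃ f g : ℂ → ℂ, IsMatchingPair Γ f g

/-- `F` maps `U` conformally (biholomorphically) onto `V`. -/
def IsConformalOnto (F : ℂ → ℂ) (U V : Set ℂ) : Prop :=
  DifferentiableOn ℂ F U ∧ BijOn F U V

/-- The homeomorphism `h` of the unit circle is a conformal welding `G⁻¹ ∘ F` of `Γ`, where
`F : 𝔻 → Ω` and `G : 𝔻* → Ω*` are conformal with `G(∞) = ∞`. The maps `F` and `G` are given on the
open domains only; the equation `G ∘ h = F` on the circle is an equation between their boundary
values, that is, between unrestricted limits from within the domains. -/
def IsConformalWelding (Γ : Set ℂ) (h : Circle ≃ₜ Circle) : Prop :=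
  ∃ F G : ℂ → ℂ,
    IsConformalOnto F disk (inside Γ) ∧
    IsConformalOnto G exteriorDisk (outside Γ) ∧
    Tendsto G (Bornology.cobounded ℂ) (Bornology.cobounded ℂ) ∧
    ∀ ζ : Circle, ∃ p : ℂ,
      Tendsto F (𝓝[disk] (ζ : ℂ)) (𝓝 p) ∧
      Tendsto G (𝓝[exteriorDisk] ((h ζ : Circle) : ℂ)) (𝓝 p)

end Matching

/-! Let E and D be the continuous extensions of the two conformal maps to the closed disk and closed
exterior, so that E = D ∘ h on the circle. A matching pair (f, g) gives f ∘ E and g ∘ D, with f ∘ E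
= conj (g ∘ D ∘ h) on the circle. Conjugating g ∘ D and composing with z ↦ 1/z̄ moves it into the
disk algebra, leaves its conjugate boundary values unchanged and turns its zero at ∞ into a zero at
0. Conversely, after subtracting ψ(0) from φ and ψ, the maps φ ∘ E⁻¹ and (reflected ψ) ∘ D⁻¹ form a
matching pair. This needs E and D to be injective up to the boundary and E to map the circle onto Γ.

The boundary values lie on Γ because they are limits from inside and outside at once. Injectivity
(`IsJordanCurve.injOn_closedBall`) is the hard point. If E u = E v with u ≠ v on the circle, the
image J of the chord [u, v] meets Γ only at E u. Choose z₁, z₂ on the two sides of the chord. The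
connected set Γ \ {E u}, joined to E z₁ and E z₂ by images of segments, shows that J does not
separate these two points; Γ does not separate them either. So (w - E z₁)/(w - E z₂) has continuous
logarithms on J and on Γ. Pulled back by E, each takes equal values at u and v. Since E z - E zᵢ is
z - zᵢ times an exponential, the pieces glue to a logarithm of z - z₁ on the circle, which is
impossible (`sub_ne_sub_of_chord`). Injectivity of D follows through h, and surjectivity onto Γ
holds because an injective continuous self-map of the circle is onto. -/

namespace Matching

/-! ### Continuous logarithms -/

/-- `f` has a continuous logarithm on `K`. -/
def HasLogOn {X : Type*} [TopologicalSpace X] (f : X → ℂ) (K : Set X) : Prop :=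
  ∃ l : X → ℂ, ContinuousOn l K ∧ ∀ z ∈ K, Complex.exp (l z) = f z

section HasLogOn

variable {X : Type*} [TopologicalSpace X] {f g : X → ℂ} {K : Set X}

theorem HasLogOn.congr (hf : HasLogOn f K) (h : ∀ z ∈ K, f z = g z) : HasLogOn g K := by
  obtain ⟨l, hl, hl'⟩ := hf
  exact ⟨l, hl, fun z hz => (hl' z hz).trans (h z hz)⟩

theorem HasLogOn.mul (hf : HasLogOn f K) (hg : HasLogOn g K) :
    HasLogOn (fun z => f z * g z) K := by
  obtain ⟨l, hl, hl'⟩ := hf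
  obtain ⟨m, hm, hm'⟩ := hg
  exact ⟨fun z => l z + m z, hl.add hm, fun z hz => by rw [Complex.exp_add, hl' z hz, hm' z hz]⟩

theorem HasLogOn.inv (hf : HasLogOn f K) : HasLogOn (fun z => (f z)⁻¹) K := by
  obtain ⟨l, hl, hl'⟩ := hf
  exact ⟨fun z => -l z, hl.neg, fun z hz => by rw [Complex.exp_neg, hl' z hz]⟩

theorem HasLogOn.div (hf : HasLogOn f K) (hg : HasLogOn g K) :
    HasLogOn (fun z => f z / g z) K := by
  simpa only [div_eq_mul_inv] using hf.mul hg.inv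

theorem hasLogOn_of_mem_slitPlane (hf : ContinuousOn f K)
    (h : ∀ z ∈ K, f z ∈ Complex.slitPlane) : HasLogOn f K :=
  ⟨fun z => Complex.log (f z), hf.clog h,
    fun z hz => Complex.exp_log (Complex.slitPlane_ne_zero (h z hz))⟩

end HasLogOn

theorem eq_zero_of_exp_eq_one_of_norm_lt_one {u : ℂ} (h : Complex.exp u = 1) (hu : ‖u‖ < 1) :
    u = 0 := by
  have him : |u.im| < 1 := (Complex.abs_im_le_norm u).trans_lt hu
  rw [abs_lt] at him
  have := Complex.log_exp (x := u) (by linarith [Real.pi_gt_three]) (by linarith [Real.pi_gt_three])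
  rw [← this, h, Complex.log_one]

/-- Two continuous logarithms of the same function on a connected set differ by a constant. -/
theorem sub_eq_sub_of_exp_eq_exp {X : Type*} [TopologicalSpace X] {S : Set X}
    (hS : IsPreconnected S) {l m : X → ℂ} (hl : ContinuousOn l S) (hm : ContinuousOn m S)
    (h : ∀ x ∈ S, Complex.exp (l x) = Complex.exp (m x)) {x y : X} (hx : x ∈ S) (hy : y ∈ S) :
    l x - m x = l y - m y := by
  refine hS.induction₂ (fun x y => l x - m x = l y - m y) ?_ (fun _ _ _ _ _ _ => Eq.trans)
    (fun _ _ _ _ => Eq.symm) hx hy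
  intro x hx
  have hd : ContinuousWithinAt (fun y => l y - m y) S x := (hl.sub hm) x hx
  filter_upwards [hd (Metric.ball_mem_nhds _ one_pos), self_mem_nhdsWithin] with y hy hyS
  have h1 : ‖(l y - m y) - (l x - m x)‖ < 1 := by simpa [dist_eq_norm] using hy
  refine (sub_eq_zero.1 (eq_zero_of_exp_eq_one_of_norm_lt_one ?_ h1)).symm
  rw [Complex.exp_sub, Complex.exp_sub, Complex.exp_sub, h y hyS, h x hx]
  simp [Complex.exp_ne_zero]

/-- A continuous function without zeros on a compact star-shaped set has a continuous logarithm. -/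
theorem hasLogOn_of_starConvex {K : Set ℂ} {c : ℂ} (hK : IsCompact K) (hc : StarConvex ℝ c K)
    {f : ℂ → ℂ} (hf : ContinuousOn f K) (h0 : ∀ z ∈ K, f z ≠ 0) : HasLogOn f K := by
  rcases K.eq_empty_or_nonempty with rfl | hne
  · exact ⟨0, continuousOn_empty _, by simp⟩
  have hcK : c ∈ K := hc.mem hne
  obtain ⟨z0, hz0, hmin⟩ := hK.exists_isMinOn hne hf.norm
  obtain ⟨R, hR, hKR⟩ := hK.isBounded.subset_closedBall_lt 0 c
  obtain ⟨ε, hε, hunif⟩ := Metric.uniformContinuousOn_iff.1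
    (hK.uniformContinuousOn_of_continuous hf) ‖f z0‖ (norm_pos_iff.2 (h0 z0 hz0))
  obtain ⟨n, hn⟩ := exists_nat_gt (R / ε)
  have hn0 : (0 : ℝ) < n := (div_pos hR hε).trans hn
  -- The contraction to c in n steps, each moving points by less than ε. As ‖f z0‖ is the minimum of
  -- ‖f‖, consecutive quotients of f along the steps stay within 1 of 1.
  let p : ℕ → ℂ → ℂ := fun i z => c + ((i : ℝ) / n) • (z - c)
  have hp : ∀ i ≤ n, ∀ z ∈ K, p i z ∈ K := fun i hi z hz =>
    hc.add_smul_sub_mem hz (by positivity)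
      (div_le_one_of_le₀ (by exact_mod_cast hi) hn0.le)
  have hpc : ∀ i, Continuous (p i) := fun i => by fun_prop
  have hfp : ∀ i ≤ n, ContinuousOn (fun z => f (p i z)) K := fun i hi =>
    hf.comp (hpc i).continuousOn (hp i hi)
  have key : ∀ i ≤ n, HasLogOn (fun z => f (p i z)) K := by
    intro i
    induction i with
    | zero =>
      intro _
      refine ⟨fun _ => Complex.log (f c), continuousOn_const, fun z _ => ?_⟩
      simp [p, Complex.exp_log (h0 c hcK)]
    | succ i ih =>
      intro hi
      have hi' : i ≤ n := by omega
      have hq : HasLogOn (fun z => f (p (i + 1) z) / f (p i z)) K := by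
        refine hasLogOn_of_mem_slitPlane
          ((hfp _ hi).div (hfp i hi') fun z hz => h0 _ (hp i hi' z hz)) fun z hz => ?_
        have hne := h0 _ (hp i hi' z hz)
        have hdist : dist (p (i + 1) z) (p i z) < ε := by
          have : p (i + 1) z - p i z = ((1 : ℝ) / n) • (z - c) := by
            simp only [p, Complex.real_smul]
            push_cast
            ring
          rw [dist_eq_norm, this, norm_smul, Real.norm_of_nonneg (by positivity)]
          have hzR : ‖z - c‖ ≤ R := by simpa [dist_eq_norm] using hKR hz
          calc 1 / n * ‖z - c‖ ≤ 1 / n * R := by gcongr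
            _ = R / n := by ring
            _ < ε := by rwa [div_lt_iff₀ hn0, mul_comm, ← div_lt_iff₀ hε]
        have h1 := hunif _ (hp _ hi z hz) _ (hp i hi' z hz) hdist
        rw [dist_eq_norm] at h1
        have h2 : ‖f (p (i + 1) z) / f (p i z) - 1‖ < 1 := by
          rw [div_sub_one hne, norm_div, div_lt_one (norm_pos_iff.2 hne)]
          exact h1.trans_le (hmin (hp i hi' z hz))
        simpa using Complex.mem_slitPlane_of_norm_lt_one h2
      refine (hq.mul (ih hi')).congr fun z hz => ?_
      exact div_mul_cancel₀ _ (h0 _ (hp i hi' z hz))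
  refine (key n le_rfl).congr fun z _ => ?_
  have hn1 : (n : ℂ) ≠ 0 := by exact_mod_cast hn0.ne'
  simp [p, hn1]

/-- The function `z - a` has no continuous logarithm on the unit circle if `a` lies inside. -/
theorem not_hasLogOn_sphere {a : ℂ} (ha : ‖a‖ < 1) :
    ¬ HasLogOn (fun z => z - a) (Metric.sphere (0 : ℂ) 1) := by
  intro h
  -- On the circle z = (z - a) / (1 - a/z), which reduces the claim to a = 0.
  have h1 : HasLogOn (fun z : ℂ => 1 - a / z) (Metric.sphere 0 1) := by
    refine hasLogOn_of_mem_slitPlane ?_ fun z hz => ?_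
    · refine continuousOn_const.sub (continuousOn_const.div continuousOn_id fun z hz => ?_)
      exact ne_zero_of_mem_unit_sphere ⟨z, hz⟩
    · rw [sub_eq_add_neg]
      refine Complex.mem_slitPlane_of_norm_lt_one ?_
      rw [mem_sphere_zero_iff_norm] at hz
      simpa [hz] using ha
  obtain ⟨l, hl, hl'⟩ : HasLogOn (fun z : ℂ => z) (Metric.sphere 0 1) := by
    refine (h.div h1).congr fun z hz => ?_
    have hz0 : z ≠ 0 := ne_zero_of_mem_unit_sphere ⟨z, hz⟩
    have hza : z - a ≠ 0 := by
      rintro h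
      rw [mem_sphere_zero_iff_norm, sub_eq_zero.1 h] at hz
      exact ha.ne hz
    field_simp
  have hmem : ∀ t : ℝ, Complex.exp (t * Complex.I) ∈ Metric.sphere (0 : ℂ) 1 := fun t => by
    simp [Complex.norm_exp_ofReal_mul_I]
  have hcont : Continuous fun t : ℝ => l (Complex.exp (t * Complex.I)) :=
    hl.comp_continuous (by fun_prop) hmem
  -- Along t ↦ exp (it) the logarithm would be it plus a constant, yet it has the same value at 0
  -- and 2π.
  have := sub_eq_sub_of_exp_eq_exp isPreconnected_univ hcont.continuousOn
    (m := fun t : ℝ => (t : ℂ) * Complex.I) (by fun_prop)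
    (fun t _ => hl' _ (hmem t)) (mem_univ (0 : ℝ)) (mem_univ (2 * Real.pi))
  simp only [Complex.ofReal_zero, zero_mul, sub_zero, Complex.ofReal_mul, Complex.ofReal_ofNat,
    Complex.exp_zero, Complex.exp_two_pi_mul_I] at this
  simpa [Real.pi_ne_zero] using sub_eq_self.1 this.symm

/-- Points of a connected set that misses the compact set `K` are not separated by `K`. -/
theorem hasLogOn_div_of_isPreconnected {K C : Set ℂ} (hK : IsCompact K) (hC : IsPreconnected C)
    (hCK : Disjoint C K) {x y : ℂ} (hx : x ∈ C) (hy : y ∈ C) :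
    HasLogOn (fun w => (w - x) / (w - y)) K := by
  have hne : ∀ x ∈ C, ∀ w ∈ K, w - x ≠ 0 := fun x hx w hw h =>
    hCK.le_bot ⟨sub_eq_zero.1 h ▸ hx, hw⟩
  -- This is an equivalence relation on C with relatively open classes: for y close to x, (w - y)/(w
  -- - x) is within 1 of 1.
  refine hC.induction₂ (fun x y => HasLogOn (fun w => (w - x) / (w - y)) K) ?_ ?_ ?_ hx hy
  · intro x hx
    have hKx : Kᶜ ∈ 𝓝 x := hK.isClosed.isOpen_compl.mem_nhds fun h => hCK.le_bot ⟨hx, h⟩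
    obtain ⟨ε, hε, hball⟩ := Metric.mem_nhds_iff.1 hKx
    filter_upwards [nhdsWithin_le_nhds (Metric.ball_mem_nhds x hε), self_mem_nhdsWithin] with
      y hy hyC
    have : HasLogOn (fun w => (w - y) / (w - x)) K := by
      refine hasLogOn_of_mem_slitPlane ((continuousOn_id.sub continuousOn_const).div
        (continuousOn_id.sub continuousOn_const) (hne x hx)) fun w hw => ?_
      have h0 := hne x hx w hw
      have h2 : ‖(w - y) / (w - x) - 1‖ < 1 := by
        rw [div_sub_one h0, norm_div, div_lt_one (norm_pos_iff.2 h0), sub_sub_sub_cancel_left,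
          ← dist_eq_norm, dist_comm]
        refine (Metric.mem_ball.1 hy).trans_le ?_
        by_contra! hlt
        exact hball (by simpa [dist_eq_norm] using hlt) hw
      simpa using Complex.mem_slitPlane_of_norm_lt_one h2
    exact this.inv.congr fun w _ => inv_div _ _
  · intro x y z _ hy _ h1 h2
    exact (h1.mul h2).congr fun w hw => div_mul_div_cancel₀ (hne y hy w hw)
  · intro x y _ _ h
    exact h.inv.congr fun w _ => inv_div _ _

end Matching

namespace Matching

/-! ### Injective holomorphic functions -/

section Inverse

variable {U : Set ℂ} {E H : ℂ → ℂ}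

theorem nhds_le_map_nhds_of_injOn (hU : IsOpen U) (hE : DifferentiableOn ℂ E U) (hi : InjOn E U)
    {z : ℂ} (hz : z ∈ U) : 𝓝 (E z) ≤ map E (𝓝 z) := by
  refine (hE.analyticAt (hU.mem_nhds hz)).eventually_constant_or_nhds_le_map_nhds.resolve_left
    fun h => ?_
  have : ∀ᶠ w in 𝓝 z, w = z := by
    filter_upwards [h, hU.mem_nhds hz] with w hw hwU using hi hwU hz hw
  obtain ⟨w, hw, hw'⟩ := ((this.filter_mono nhdsWithin_le_nhds).and
    (eventually_mem_nhdsWithin (a := z) (s := {z}ᶜ))).exists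
  exact hw' hw

theorem isOpen_image_of_injOn (hU : IsOpen U) (hE : DifferentiableOn ℂ E U) (hi : InjOn E U) :
    IsOpen (E '' U) := by
  rw [isOpen_iff_mem_nhds]
  rintro _ ⟨z, hz, rfl⟩
  exact nhds_le_map_nhds_of_injOn hU hE hi hz (image_mem_map (hU.mem_nhds hz))

theorem continuousAt_of_leftInvOn (hU : IsOpen U) (hE : DifferentiableOn ℂ E U)
    (hH : LeftInvOn H E U) {z : ℂ} (hz : z ∈ U) : ContinuousAt H (E z) := by
  have h1 := nhds_le_map_nhds_of_injOn hU hE hH.injOn hz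
  have h2 : Tendsto (H ∘ E) (𝓝 z) (𝓝 z) :=
    tendsto_id.congr' <| by filter_upwards [hU.mem_nhds hz] with w hw using (hH hw).symm
  unfold ContinuousAt
  rw [hH hz]
  exact (tendsto_map'_iff.2 h2).mono_left h1

/-- The inverse of an injective holomorphic function is holomorphic. -/
theorem differentiableOn_of_leftInvOn (hU : IsOpen U) (hE : DifferentiableOn ℂ E U)
    (hH : LeftInvOn H E U) : DifferentiableOn ℂ H (E '' U) := by
  have hopen := isOpen_image_of_injOn hU hE hH.injOn
  have hreg : ∀ z ∈ U, deriv E z ≠ 0 → DifferentiableAt ℂ H (E z) := by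
    intro z hz hd
    refine (HasDerivAt.of_local_left_inverse (f := E) (f' := deriv E z)
      (continuousAt_of_leftInvOn hU hE hH hz) ?_ hd ?_).differentiableAt
    · rw [hH hz]
      exact (hE.differentiableAt (hU.mem_nhds hz)).hasDerivAt
    · filter_upwards [hopen.mem_nhds (mem_image_of_mem E hz)]
      rintro _ ⟨w, hw, rfl⟩
      rw [hH hw]
  rintro _ ⟨z, hz, rfl⟩
  refine DifferentiableAt.differentiableWithinAt ?_
  -- A zero of E' is isolated, since otherwise E is constant on a ball. Hence H is holomorphic on a
  -- punctured neighbourhood of E z and continuous at E z, and the singularity is removable.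
  have han : AnalyticAt ℂ (deriv E) z := (hE.analyticAt (hU.mem_nhds hz)).deriv
  rcases han.eventually_eq_zero_or_eventually_ne_zero with h0 | h0
  · exfalso
    obtain ⟨r, hr, hball⟩ := Metric.mem_nhds_iff.1 (inter_mem h0 (hU.mem_nhds hz))
    have hw : z + (r / 2 : ℝ) ∈ Metric.ball z r := by
      simp only [Metric.mem_ball, dist_self_add_left, Complex.norm_real, Real.norm_eq_abs]
      rw [abs_of_pos (by positivity)]
      linarith
    have := (convex_ball z r).is_const_of_fderivWithin_eq_zero (𝕜 := ℂ) (f := E)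
      (hE.mono fun w hw => (hball hw).2) (fun w hw => ?_) hw (Metric.mem_ball_self hr)
    · have := hH.injOn (hball hw).2 hz this
      simp [hr.ne'] at this
    · rw [fderivWithin_of_isOpen Metric.isOpen_ball hw]
      ext
      simpa using (hball hw).1
  · refine AnalyticAt.differentiableAt
      (Complex.analyticAt_of_differentiable_on_punctured_nhds_of_continuousAt ?_
        (continuousAt_of_leftInvOn hU hE hH hz))
    have hV : E '' U ∈ 𝓝 (E z) := hopen.mem_nhds (mem_image_of_mem E hz)
    have hpull : ∀ᶠ w in 𝓝 (E z), H w ≠ z → deriv E (H w) ≠ 0 := by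
      have := continuousAt_of_leftInvOn hU hE hH hz
      rw [ContinuousAt, hH hz] at this
      exact this.eventually (eventually_nhdsWithin_iff.1 h0)
    filter_upwards [nhdsWithin_le_nhds hpull, nhdsWithin_le_nhds hV, self_mem_nhdsWithin]
    rintro _ hw ⟨v, hv, rfl⟩ hne
    rw [hH hv] at hw
    exact hreg v hv (hw fun h => hne (by rw [h]; rfl))

theorem deriv_ne_zero_of_injOn (hU : IsOpen U) (hE : DifferentiableOn ℂ E U) (hi : InjOn E U)
    {z : ℂ} (hz : z ∈ U) : deriv E z ≠ 0 := by
  have hH := hi.leftInvOn_invFunOn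
  have hopen := isOpen_image_of_injOn hU hE hi
  have h1 := ((differentiableOn_of_leftInvOn hU hE hH).differentiableAt
    (hopen.mem_nhds (mem_image_of_mem E hz))).hasDerivAt
  have h2 := (hE.differentiableAt (hU.mem_nhds hz)).hasDerivAt
  have h3 := h1.comp z h2
  have h4 : HasDerivAt (Function.invFunOn E U ∘ E) 1 z :=
    (hasDerivAt_id z).congr_of_eventuallyEq <| by
      filter_upwards [hU.mem_nhds hz] with w hw using hH hw
  intro h0
  rw [h0, mul_zero] at h3
  exact zero_ne_one (h3.unique h4)

end Inverse

/-! ### Uniqueness for boundary values on an arc -/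

/-- A function that is continuous on the closed disk, holomorphic in the disk and constant on a
nonempty relatively open subset of the circle is not injective in the disk. -/
theorem not_injOn_of_eq_on_arc {E : ℂ → ℂ} (hc : ContinuousOn E (Metric.closedBall 0 1))
    (hd : DifferentiableOn ℂ E (Metric.ball 0 1)) {V : Set ℂ} (hV : IsOpen V) {a : ℂ}
    (haV : a ∈ V) (ha : ‖a‖ = 1) {p : ℂ} (hp : ∀ z ∈ V, ‖z‖ = 1 → E z = p) :
    ¬ InjOn E (Metric.ball 0 1) := by
  intro hi
  let W : Set Circle := {c | (c : ℂ) ∈ V}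
  have hW : IsOpen W := hV.preimage continuous_subtype_val
  obtain ⟨t, ht⟩ := compact_covered_by_mul_left_translates (K := (univ : Set Circle)) (V := W)
    isCompact_univ (by
      rw [hW.interior_eq]
      exact ⟨⟨a, mem_sphere_zero_iff_norm.2 ha⟩, haV⟩)
  have hrot : ∀ c : Circle, ∀ r : Set ℂ, r = Metric.ball 0 1 ∨ r = Metric.closedBall 0 1 →
      MapsTo (fun z => (c : ℂ) * z) r r := by
    rintro c r (rfl | rfl) z hz <;> simpa [Circle.norm_coe] using hz
  -- Finitely many rotations of the arc cover the circle, so this product vanishes there and hence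
  -- in the disk. Injectivity allows each factor only one zero.
  let P : ℂ → ℂ := fun z => ∏ c ∈ t, (E (c * z) - p)
  have hP : DiffContOnCl ℂ P (Metric.ball 0 1) := by
    refine ⟨DifferentiableOn.fun_finsetProd fun c _ => (hd.comp (by fun_prop)
      (hrot c _ (Or.inl rfl))).sub_const _, ?_⟩
    rw [closure_ball _ one_ne_zero]
    exact continuousOn_finsetProd _ fun c _ => (hc.comp (by fun_prop)
      (hrot c _ (Or.inr rfl))).sub continuousOn_const
  have h0 : ∀ z ∈ Metric.ball (0 : ℂ) 1, P z = 0 := by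
    refine Complex.eqOn_of_eqOn_frontier (g := fun _ => 0) Metric.isBounded_ball hP
      diffContOnCl_const ?_
    intro z hz
    rw [frontier_ball _ one_ne_zero] at hz
    obtain ⟨c, hct, hcV⟩ := mem_iUnion₂.1 (ht (mem_univ (⟨z, hz⟩ : Circle)))
    refine Finset.prod_eq_zero hct ?_
    rw [sub_eq_zero]
    exact hp _ hcV (by simpa [Circle.norm_coe] using hz)
  have hfin : (Metric.ball (0 : ℂ) 1 ∩ {z | P z = 0}).Finite := by
    have : Metric.ball (0 : ℂ) 1 ∩ {z | P z = 0} ⊆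
        ⋃ c ∈ t, (Metric.ball (0 : ℂ) 1 ∩ {z | E (c * z) = p}) := by
      rintro z ⟨hz, hPz⟩
      obtain ⟨c, hct, h⟩ := Finset.prod_eq_zero_iff.1 hPz
      exact mem_biUnion hct ⟨hz, sub_eq_zero.1 h⟩
    refine (t.finite_toSet.biUnion fun c _ => Subsingleton.finite ?_).subset this
    rintro z ⟨hz, hz'⟩ w ⟨hw, hw'⟩
    have := hi (hrot c _ (Or.inl rfl) hz) (hrot c _ (Or.inl rfl) hw) (hz'.trans hw'.symm)
    exact mul_left_cancel₀ c.coe_ne_zero this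
  refine infinite_of_mem_nhds (0 : ℂ) (Metric.ball_mem_nhds 0 one_pos) (hfin.subset ?_)
  exact fun z hz => ⟨hz, h0 z hz⟩

/-! ### Jordan curves -/

theorem IsJordanCurve.isCompact {Γ : Set ℂ} (hΓ : IsJordanCurve Γ) : IsCompact Γ := by
  obtain ⟨γ, hγ, -, rfl⟩ := hΓ
  exact isCompact_range hγ

theorem IsJordanCurve.isPreconnected_sdiff_singleton {Γ : Set ℂ} (hΓ : IsJordanCurve Γ) {p : ℂ}
    (hp : p ∈ Γ) : IsPreconnected (Γ \ {p}) := by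
  obtain ⟨γ, hγ, hi, rfl⟩ := hΓ
  obtain ⟨c, rfl⟩ := hp
  have : range γ \ {γ c} = (fun t : ℝ => γ (c * Circle.exp t)) '' Ioo 0 (2 * Real.pi) := by
    ext w
    constructor
    · rintro ⟨⟨d, rfl⟩, hd⟩
      have hdc : d ≠ c := fun h => hd (by rw [h]; rfl)
      refine ⟨Circle.angleDiff c d, ⟨Circle.angleDiff_pos hdc.symm, Circle.angleDiff_lt_two_pi c d⟩,
        ?_⟩
      simp only [mul_comm c, Circle.exp_angleDiff_mul]
    · rintro ⟨t, ht, rfl⟩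
      refine ⟨mem_range_self _, fun h => ?_⟩
      have h1 : Circle.exp t = 1 := by simpa using hi h
      rw [← Circle.exp_zero] at h1
      exact ht.1.ne' (Circle.exp_injOn_Ico (a := 0) (b := 2 * Real.pi) (by simp)
        ⟨ht.1.le, ht.2⟩ ⟨le_rfl, Real.two_pi_pos⟩ h1)
  rw [this]
  exact isPreconnected_Ioo.image _ (by fun_prop)

end Matching

namespace Matching

/-! ### Injectivity of the boundary values -/

/-- The set is the segment from a to the midpoint of a and u; by strict convexity of the disk only
the endpoint a lies on the circle. -/
theorem exists_convex_of_lt {ℓ : ℂ →L[ℝ] ℝ} {r : ℝ} {u a : ℂ} (hu : ‖u‖ = 1) (hur : ℓ u = r)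
    (ha : ‖a‖ = 1) (har : r < ℓ a) :
    ∃ (S : Set ℂ) (w : ℂ), Convex ℝ S ∧ a ∈ S ∧ w ∈ S ∧ ‖w‖ < 1 ∧
      ∀ z ∈ S, r < ℓ z ∧ (z = a ∨ ‖z‖ < 1) := by
  have hau : a ≠ u := fun h => har.ne' (by rw [h, hur])
  have hs := strictConvex_closedBall ℝ (0 : ℂ) 1
  have ha' : a ∈ Metric.closedBall (0 : ℂ) 1 := by simp [ha]
  have hu' : u ∈ Metric.closedBall (0 : ℂ) 1 := by simp [hu]
  let w : ℂ := (2⁻¹ : ℝ) • a + (2⁻¹ : ℝ) • u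
  have hw : ‖w‖ < 1 := by
    have := hs ha' hu' hau (by norm_num : (0 : ℝ) < 2⁻¹) (by norm_num : (0 : ℝ) < 2⁻¹) (by norm_num)
    rw [interior_closedBall _ one_ne_zero] at this
    simpa [w] using this
  have hw' : w ∈ Metric.closedBall (0 : ℂ) 1 := by simpa using hw.le
  have hwa : w ≠ a := fun h => by rw [h] at hw; exact hw.ne ha
  have hwr : r < ℓ w := by
    simp only [w, map_add, map_smul, smul_eq_mul, hur]
    linarith
  refine ⟨segment ℝ w a, w, convex_segment w a, right_mem_segment ℝ w a, left_mem_segment ℝ w a,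
    hw, fun z hz => ⟨?_, ?_⟩⟩
  · exact (convex_halfSpace_gt ℓ.toLinearMap.isLinear r).segment_subset hwr har hz
  · rw [← insert_endpoints_openSegment] at hz
    rcases hz with rfl | rfl | hz
    · exact Or.inr hw
    · exact Or.inl rfl
    · have := hs.openSegment_subset hw' ha' hwa hz
      rw [interior_closedBall _ one_ne_zero] at this
      exact Or.inr (by simpa using this)

/-- The real-linear functional that cuts the circle at two given points. -/
theorem exists_chord {u v : ℂ} (hu : ‖u‖ = 1) (hv : ‖v‖ = 1) (huv : u ≠ v) :
    ∃ ℓ : ℂ →L[ℝ] ℝ, ℓ v = ℓ u ∧ (∀ z, ‖z‖ = 1 → ℓ z = ℓ u → z = u ∨ z = v) ∧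
      (∃ a, ‖a‖ = 1 ∧ ℓ u < ℓ a) ∧ ∃ b, ‖b‖ = 1 ∧ ℓ b < ℓ u := by
  have hd : v - u ≠ 0 := sub_ne_zero.2 huv.symm
  have hd' : 0 < ‖v - u‖ := norm_pos_iff.2 hd
  let ℓ : ℂ →L[ℝ] ℝ := Complex.imCLM.comp
    ((ContinuousLinearMap.mul ℝ ℂ).flip (starRingEnd ℂ (v - u)))
  have hℓ : ∀ z, ℓ z = z.im * (v.re - u.re) - z.re * (v.im - u.im) := fun z => by
    simp [ℓ]
    ring
  have hu2 : u.re ^ 2 + u.im ^ 2 = 1 := by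
    have := Complex.sq_norm u; rw [hu, Complex.normSq_apply] at this; linarith
  have hv2 : v.re ^ 2 + v.im ^ 2 = 1 := by
    have := Complex.sq_norm v; rw [hv, Complex.normSq_apply] at this; linarith
  have hn2 : ‖v - u‖ ^ 2 = (v.re - u.re) ^ 2 + (v.im - u.im) ^ 2 := by
    rw [Complex.sq_norm, Complex.normSq_apply]; simp; ring
  -- With s = Re (u v̄) < 1, the difference of squares ‖v - u‖² - (ℓ u)² is (1 - s)².
  have hlt : |ℓ u| < ‖v - u‖ := by
    rw [← sq_lt_sq₀ (abs_nonneg _) hd'.le, sq_abs, hn2, hℓ]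
    have h1 : 0 < (v.re - u.re) ^ 2 + (v.im - u.im) ^ 2 := by rw [← hn2]; positivity
    have h2 : u.re * v.re + u.im * v.im < 1 := by nlinarith
    nlinarith [mul_pos (sub_pos.2 h2) (sub_pos.2 h2)]
  let a : ℂ := Complex.I * (v - u) / ‖v - u‖
  have ha : ‖a‖ = 1 := by
    simp [a, hd'.ne']
  have hℓa : ℓ a = ‖v - u‖ := by
    rw [hℓ]
    have h1 : a.re = -(v.im - u.im) / ‖v - u‖ := by
      simp only [a, Complex.div_ofReal_re]; simp
    have h2 : a.im = (v.re - u.re) / ‖v - u‖ := by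
      simp only [a, Complex.div_ofReal_im]; simp
    rw [h1, h2]
    field_simp
    rw [hn2]
    ring
  rw [abs_lt] at hlt
  refine ⟨ℓ, ?_, ?_, ⟨a, ha, by rw [hℓa]; exact hlt.2⟩, -a, by rwa [norm_neg], ?_⟩
  · rw [hℓ, hℓ]; ring
  · intro z hz hzu
    have hz2 : z.re ^ 2 + z.im ^ 2 = 1 := by
      have := Complex.sq_norm z; rw [hz, Complex.normSq_apply] at this; linarith
    have him : ((z - u) / (v - u)).im = 0 := by
      rw [Complex.div_im]
      rw [hℓ, hℓ] at hzu
      rw [← sub_div]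
      refine div_eq_zero_iff.2 (Or.inl ?_)
      simp only [Complex.sub_re, Complex.sub_im]
      linear_combination hzu
    obtain ⟨t, ht⟩ : ∃ t : ℝ, (z - u) / (v - u) = t :=
      ⟨_, Complex.ext rfl (by simpa using him)⟩
    rw [div_eq_iff hd] at ht
    have hre : z.re = u.re + t * (v.re - u.re) := by
      have := congrArg Complex.re ht; simp at this; linarith
    have him' : z.im = u.im + t * (v.im - u.im) := by
      have := congrArg Complex.im ht; simp at this; linarith
    have hprod : t * (t - 1) * ‖v - u‖ ^ 2 = 0 := by
      rw [hn2]
      rw [hre, him'] at hz2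
      linear_combination hz2 - (1 - t) * hu2 - t * hv2
    rcases mul_eq_zero.1 hprod with h | h
    · rcases mul_eq_zero.1 h with h | h
      · left; rw [h] at ht; simpa [sub_eq_zero] using ht
      · right
        rw [sub_eq_zero.1 h] at ht; simpa using ht
    · exact absurd h (by positivity)
  · rw [map_neg, hℓa]; exact hlt.1

section Boundary

variable {Γ : Set ℂ} {E : ℂ → ℂ}

/-- The divided difference has no zero: at w by E' w ≠ 0, elsewhere in the disk by injectivity, and
on the circle because E lands in Γ there while E w does not. It serves to replace E z - E w by z -
w. -/
theorem hasLogOn_dslope (hc : ContinuousOn E (Metric.closedBall 0 1))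
    (hd : DifferentiableOn ℂ E (Metric.ball 0 1)) (hi : InjOn E (Metric.ball 0 1))
    (hball : ∀ z, ‖z‖ < 1 → E z ∉ Γ) (hsph : ∀ z, ‖z‖ = 1 → E z ∈ Γ) {w : ℂ} (hw : ‖w‖ < 1) :
    HasLogOn (dslope E w) (Metric.closedBall 0 1) := by
  have hw' : w ∈ Metric.ball (0 : ℂ) 1 := by simpa using hw
  refine hasLogOn_of_starConvex (c := 0) (isCompact_closedBall 0 1)
    ((convex_closedBall (0 : ℂ) 1).starConvex (by simp))
    ((continuousOn_dslope (mem_of_superset (Metric.isOpen_ball.mem_nhds hw')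
      Metric.ball_subset_closedBall)).2
      ⟨hc, hd.differentiableAt (Metric.isOpen_ball.mem_nhds hw')⟩) fun z hz => ?_
  by_cases hzw : z = w
  · rw [hzw, dslope_same]
    exact deriv_ne_zero_of_injOn Metric.isOpen_ball hd hi hw'
  · have hne : E z ≠ E w := by
      rcases (mem_closedBall_zero_iff.1 hz).lt_or_eq with h | h
      · exact fun h' => hzw (hi (by simpa using h) hw' h')
      · exact fun h' => hball w hw (h' ▸ hsph z h)
    rw [dslope_of_ne _ hzw, slope_def_field]
    exact div_ne_zero (sub_ne_zero.2 hne) (sub_ne_zero.2 hzw)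

/-- There is no continuous logarithm of the quotient of `E z - E z₁` and `E z - E z₂` that is
compatible on the circle and on a chord that separates `z₁` from `z₂`. -/
theorem sub_ne_sub_of_chord (hc : ContinuousOn E (Metric.closedBall 0 1))
    (hd : DifferentiableOn ℂ E (Metric.ball 0 1)) (hi : InjOn E (Metric.ball 0 1))
    (hball : ∀ z, ‖z‖ < 1 → E z ∉ Γ) (hsph : ∀ z, ‖z‖ = 1 → E z ∈ Γ)
    {ℓ : ℂ →L[ℝ] ℝ} {u v z₁ z₂ : ℂ} (hu : ‖u‖ = 1) (hv : ‖v‖ = 1) (huv : ℓ v = ℓ u)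
    (hchord : ∀ z, ‖z‖ = 1 → ℓ z = ℓ u → z = u ∨ z = v)
    (hz₁ : ‖z₁‖ < 1) (hz₂ : ‖z₂‖ < 1) (h₁ : ℓ u < ℓ z₁) (h₂ : ℓ z₂ < ℓ u) {lT lV : ℂ → ℂ}
    (hlT : ContinuousOn lT (Metric.sphere 0 1))
    (hlT' : ∀ z ∈ Metric.sphere (0 : ℂ) 1, Complex.exp (lT z) = (E z - E z₁) / (E z - E z₂))
    (hlV : ContinuousOn lV (Metric.closedBall 0 1 ∩ {z | ℓ z = ℓ u}))
    (hlV' : ∀ z ∈ Metric.closedBall (0 : ℂ) 1 ∩ {z | ℓ z = ℓ u},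
      Complex.exp (lV z) = (E z - E z₁) / (E z - E z₂)) :
    lT u - lV u ≠ lT v - lV v := by
  intro hTV
  have hlin := ℓ.toLinearMap.isLinear
  have hK := isCompact_closedBall (0 : ℂ) 1
  obtain ⟨m₁, hm₁, hm₁'⟩ := hasLogOn_dslope hc hd hi hball hsph hz₁
  obtain ⟨m₂, hm₂, hm₂'⟩ := hasLogOn_dslope hc hd hi hball hsph hz₂
  have conv₁ : Convex ℝ (Metric.closedBall (0 : ℂ) 1 ∩ {z | ℓ u ≤ ℓ z}) :=
    (convex_closedBall _ _).inter (convex_halfSpace_ge hlin _)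
  have conv₂ : Convex ℝ (Metric.closedBall (0 : ℂ) 1 ∩ {z | ℓ z ≤ ℓ u}) :=
    (convex_closedBall _ _).inter (convex_halfSpace_le hlin _)
  have conv : Convex ℝ (Metric.closedBall (0 : ℂ) 1 ∩ {z | ℓ z = ℓ u}) :=
    (convex_closedBall _ _).inter (convex_hyperplane hlin _)
  have hu' : u ∈ Metric.closedBall (0 : ℂ) 1 := by simp [hu]
  have hv' : v ∈ Metric.closedBall (0 : ℂ) 1 := by simp [hv]
  -- The chord cuts the disk into two caps: z - z₂ has no zero on the cap of z₁, and z - z₁ none on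
  -- the cap of z₂.
  obtain ⟨n₁, hn₁, hn₁'⟩ : HasLogOn (fun z => z - z₂)
      (Metric.closedBall (0 : ℂ) 1 ∩ {z | ℓ u ≤ ℓ z}) :=
    hasLogOn_of_starConvex (hK.inter_right (isClosed_le continuous_const ℓ.continuous))
      (conv₁.starConvex ⟨hu', le_refl (ℓ u)⟩) (by fun_prop) fun z hz h =>
      h₂.not_ge (by rw [← sub_eq_zero.1 h]; exact hz.2)
  obtain ⟨n₂, hn₂, hn₂'⟩ : HasLogOn (fun z => z - z₁)
      (Metric.closedBall (0 : ℂ) 1 ∩ {z | ℓ z ≤ ℓ u}) :=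
    hasLogOn_of_starConvex (hK.inter_right (isClosed_le ℓ.continuous continuous_const))
      (conv₂.starConvex ⟨hu', le_refl (ℓ u)⟩) (by fun_prop) fun z hz h =>
      h₁.not_ge (by rw [← sub_eq_zero.1 h]; exact hz.2)
  have hquot : ∀ z ∈ Metric.closedBall (0 : ℂ) 1, (E z - E z₁) / (E z - E z₂) *
      (Complex.exp (m₁ z))⁻¹ * Complex.exp (m₂ z) * (z - z₂) = z - z₁ ∨ z = z₂ := by
    intro z hz
    by_cases hzz : z = z₂
    · exact Or.inr hzz
    left
    have e₁ : (z - z₁) * Complex.exp (m₁ z) = E z - E z₁ := by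
      rw [hm₁' z hz, ← smul_eq_mul, sub_smul_dslope]
    have e₂ : (z - z₂) * Complex.exp (m₂ z) = E z - E z₂ := by
      rw [hm₂' z hz, ← smul_eq_mul, sub_smul_dslope]
    rw [← e₁, ← e₂]
    have := Complex.exp_ne_zero (m₁ z)
    have := Complex.exp_ne_zero (m₂ z)
    have := sub_ne_zero.2 hzz
    field_simp
  have hquot' : ∀ z ∈ Metric.closedBall (0 : ℂ) 1, ℓ u ≤ ℓ z → ∀ x,
      Complex.exp x = (E z - E z₁) / (E z - E z₂) →
      Complex.exp (x - m₁ z + m₂ z + n₁ z) = z - z₁ := by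
    intro z hz hzl x hx
    rw [Complex.exp_add, Complex.exp_add, Complex.exp_sub, hx, hn₁' z ⟨hz, hzl⟩, div_eq_mul_inv]
    refine (hquot z hz).resolve_right ?_
    rintro rfl
    exact h₂.not_ge hzl
  have hsub : Metric.sphere (0 : ℂ) 1 ⊆ Metric.closedBall 0 1 := Metric.sphere_subset_closedBall
  -- Both sides are logarithms of z - z₁ on the chord, so their difference is the same at u and v.
  -- With `hTV` the same holds with lT in place of lV, and κ is the common offset.
  have hV := sub_eq_sub_of_exp_eq_exp conv.isPreconnected
    (l := fun z => lV z - m₁ z + m₂ z + n₁ z) (m := n₂)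
    (((hlV.sub (hm₁.mono inter_subset_left)).add (hm₂.mono inter_subset_left)).add
      (hn₁.mono fun z hz => ⟨hz.1, hz.2.ge⟩))
    (hn₂.mono fun z hz => ⟨hz.1, hz.2.le⟩)
    (fun z hz => (hquot' z hz.1 hz.2.ge _ (hlV' z hz)).trans (hn₂' z ⟨hz.1, hz.2.le⟩).symm)
    ⟨hu', rfl⟩ ⟨hv', huv⟩
  let κ : ℂ := lT u - m₁ u + m₂ u + n₁ u - n₂ u
  have hκ : lT v - m₁ v + m₂ v + n₁ v - n₂ v = κ := by
    simp only [κ]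
    linear_combination -hTV - hV
  have hκ' : Complex.exp κ = 1 := by
    rw [Complex.exp_sub, hquot' u hu' le_rfl _ (hlT' u (by simpa using hu)),
      hn₂' u ⟨hu', le_refl (ℓ u)⟩, div_self]
    rw [sub_ne_zero]
    rintro rfl
    exact hz₁.ne hu
  refine not_hasLogOn_sphere hz₁
    ⟨fun z => if ℓ u ≤ ℓ z then lT z - m₁ z + m₂ z + n₁ z else n₂ z + κ, ?_, ?_⟩
  · refine ContinuousOn.if ?_ ?_ ?_
    · rintro z ⟨hz, hzf⟩
      have hzl : ℓ u = ℓ z := frontier_le_subset_eq continuous_const ℓ.continuous hzf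
      rcases hchord z (by simpa using hz) hzl.symm with rfl | rfl
      · simp [κ]
      · rw [← hκ]; ring
    · rw [(isClosed_le continuous_const ℓ.continuous).closure_eq]
      exact ((((hlT.mono inter_subset_left).sub
        (hm₁.mono (inter_subset_left.trans hsub))).add
        (hm₂.mono (inter_subset_left.trans hsub))).add
        (hn₁.mono (inter_subset_inter_left _ hsub)))
    · refine (hn₂.mono (inter_subset_inter hsub ?_)).add continuousOn_const
      refine closure_minimal (fun z hz => ?_) (isClosed_le ℓ.continuous continuous_const)
      exact (not_le.1 hz).le
  · intro z hz
    have hz' := hsub hz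
    dsimp only
    split_ifs with h
    · exact hquot' z hz' h _ (hlT' z hz)
    · rw [Complex.exp_add, hκ', mul_one, hn₂' z ⟨hz', (not_le.1 h).le⟩]

/-- **Carathéodory**: boundary values of a conformal map that lie on a Jordan curve are taken
only once. -/
theorem IsJordanCurve.injOn_closedBall (hΓ : IsJordanCurve Γ)
    (hc : ContinuousOn E (Metric.closedBall 0 1))
    (hd : DifferentiableOn ℂ E (Metric.ball 0 1)) (hi : InjOn E (Metric.ball 0 1))
    (hball : ∀ z, ‖z‖ < 1 → E z ∉ Γ) (hsph : ∀ z, ‖z‖ = 1 → E z ∈ Γ) :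
    InjOn E (Metric.closedBall 0 1) := by
  intro u hu v hv huv
  rcases (mem_closedBall_zero_iff.1 hu).lt_or_eq with hu | hu <;>
    rcases (mem_closedBall_zero_iff.1 hv).lt_or_eq with hv | hv
  · exact hi (by simpa using hu) (by simpa using hv) huv
  · exact absurd (huv ▸ hsph v hv) (hball u hu)
  · exact absurd (huv ▸ hsph u hu) (hball v hv)
  by_contra hne
  obtain ⟨ℓ, hvu, hchord, ⟨a₀, ha₀, ha₀l⟩, ⟨b₀, hb₀, hb₀l⟩⟩ := exists_chord hu hv hne
  -- Otherwise E is constant on the whole open arc on this side of the chord.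
  obtain ⟨a, ha, hal, hap⟩ : ∃ a, ‖a‖ = 1 ∧ ℓ u < ℓ a ∧ E a ≠ E u := by
    by_contra! h
    exact not_injOn_of_eq_on_arc hc hd (isOpen_lt continuous_const ℓ.continuous) ha₀l ha₀
      (fun z hz hz1 => h z hz1 hz) hi
  obtain ⟨b, hb, hbl, hbp⟩ : ∃ b, ‖b‖ = 1 ∧ ℓ b < ℓ u ∧ E b ≠ E u := by
    by_contra! h
    exact not_injOn_of_eq_on_arc hc hd (isOpen_lt ℓ.continuous continuous_const) hb₀l hb₀
      (fun z hz hz1 => h z hz1 hz) hi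
  obtain ⟨A, z₁, hA, haA, hz₁A, hz₁, hA'⟩ := exists_convex_of_lt hu rfl ha hal
  obtain ⟨B, z₂, hB, hbB, hz₂B, hz₂, hB'⟩ := exists_convex_of_lt (ℓ := -ℓ) hu rfl hb
    (by simpa using hbl)
  let V : Set ℂ := Metric.closedBall 0 1 ∩ {z | ℓ z = ℓ u}
  have hEV : ContinuousOn E V := hc.mono inter_subset_left
  have hJ : IsCompact (E '' V) := ((isCompact_closedBall 0 1).inter_right
    (isClosed_eq ℓ.continuous continuous_const)).image_of_continuousOn hEV
  have hΓV : Disjoint (Γ \ {E u}) (E '' V) := by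
    rw [Set.disjoint_left]
    rintro _ ⟨hwΓ, hwu⟩ ⟨k, hk, rfl⟩
    rcases (mem_closedBall_zero_iff.1 hk.1).lt_or_eq with hk1 | hk1
    · exact hball k hk1 hwΓ
    · rcases hchord k hk1 hk.2 with rfl | rfl
      · exact hwu rfl
      · exact hwu huv.symm
  have hSV : ∀ S : Set ℂ, ∀ c, ‖c‖ = 1 → E c ≠ E u →
      (∀ z ∈ S, ℓ z ≠ ℓ u ∧ (z = c ∨ ‖z‖ < 1)) → Disjoint (E '' S) (E '' V) := by
    intro S c hc1 hcu hS
    rw [Set.disjoint_left]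
    rintro _ ⟨z, hz, rfl⟩ hzV
    rcases (hS z hz).2 with rfl | hz1
    · exact hΓV.le_bot ⟨⟨hsph z hc1, hcu⟩, hzV⟩
    · obtain ⟨k, hk, hkz⟩ := hzV
      rcases (mem_closedBall_zero_iff.1 hk.1).lt_or_eq with hk1 | hk1
      · have := hi (by simpa using hk1) (by simpa using hz1) hkz
        exact (hS z hz).1 (this ▸ hk.2)
      · exact hball z hz1 (hkz ▸ hsph k hk1)
  have hAc : A ⊆ Metric.closedBall 0 1 := fun z hz => by
    rcases (hA' z hz).2 with rfl | h
    · simp [ha]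
    · simpa using h.le
  have hBc : B ⊆ Metric.closedBall 0 1 := fun z hz => by
    rcases (hB' z hz).2 with rfl | h
    · simp [hb]
    · simpa using h.le
  -- A connected route from E z₁ to E z₂ through Γ \ {E u} that avoids the image of the chord.
  have hC : IsPreconnected (E '' A ∪ (Γ \ {E u}) ∪ E '' B) := by
    refine IsPreconnected.union (E b) (Or.inr ⟨hsph b hb, hbp⟩) (mem_image_of_mem E hbB)
      (IsPreconnected.union (E a) (mem_image_of_mem E haA) ⟨hsph a ha, hap⟩
        (hA.isPreconnected.image _ (hc.mono hAc))
        (hΓ.isPreconnected_sdiff_singleton (hsph u hu))) (hB.isPreconnected.image _ (hc.mono hBc))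
  obtain ⟨l₁, hl₁, hl₁'⟩ := hasLogOn_div_of_isPreconnected hJ hC
    (((hSV A a ha hap fun z hz => ⟨(hA' z hz).1.ne', (hA' z hz).2⟩).union_left hΓV).union_left
      (hSV B b hb hbp fun z hz => ⟨fun h => (hB' z hz).1.ne' (by simp [h]), (hB' z hz).2⟩))
    (Or.inl (Or.inl (mem_image_of_mem E hz₁A))) (Or.inr (mem_image_of_mem E hz₂B))
  obtain ⟨l₂, hl₂, hl₂'⟩ := hasLogOn_div_of_isPreconnected hΓ.isCompact
    ((convex_ball (0 : ℂ) 1).isPreconnected.image E hd.continuousOn)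
    (Set.disjoint_left.2 (by
      rintro _ ⟨z, hz, rfl⟩
      exact hball z (by simpa using hz)))
    (mem_image_of_mem E (by simpa using hz₁)) (mem_image_of_mem E (by simpa using hz₂))
  have hmaps : MapsTo E (Metric.sphere 0 1) Γ := fun z hz => hsph z (by simpa using hz)
  refine sub_ne_sub_of_chord hc hd hi hball hsph hu hv hvu hchord hz₁ hz₂ (hA' z₁ hz₁A).1
    (by simpa using (hB' z₂ hz₂B).1)
    (hl₂.comp (hc.mono Metric.sphere_subset_closedBall) hmaps)
    (fun z hz => hl₂' _ (hmaps hz))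
    (hl₁.comp hEV (mapsTo_image E V)) (fun z hz => hl₁' _ (mem_image_of_mem E hz)) ?_
  simp only [Function.comp_apply, huv]

end Boundary

end Matching

namespace Matching

/-! ### Surjectivity of the boundary values -/

theorem exists_circle_eq {z : ℂ} (hz : ‖z‖ = 1) : ∃ ζ : Circle, (ζ : ℂ) = z :=
  ⟨⟨z, mem_sphere_zero_iff_norm.2 hz⟩, rfl⟩

theorem circle_exp_pi : Circle.exp Real.pi = -1 :=
  Subtype.ext (by simp [Circle.coe_exp])

/-- An injective continuous map from the circle to itself is surjective. -/
theorem surjective_of_continuous_of_injective {e : Circle → Circle} (he : Continuous e)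
    (hi : Function.Injective e) : Function.Surjective e := by
  intro c
  by_contra! hc
  -- The omitted point c is rotated to -1, where `arg` jumps, so θ is a continuous injection into ℝ.
  -- The intermediate value theorem then finds antipodal points with equal θ.
  let θ : Circle → ℝ := fun z => Complex.arg ((-(c⁻¹ * e z) : Circle) : ℂ)
  have hslit : ∀ z, ((-(c⁻¹ * e z) : Circle) : ℂ) ∈ Complex.slitPlane := by
    intro z
    rw [Complex.mem_slitPlane_iff_arg]
    refine ⟨fun h => hc z ?_, Circle.coe_ne_zero _⟩
    have h1 := Circle.exp_arg (-(c⁻¹ * e z))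
    rw [h, circle_exp_pi, neg_inj] at h1
    exact (inv_mul_eq_one.1 h1.symm).symm
  have hθ : Continuous θ := continuous_iff_continuousAt.2 fun z =>
    ContinuousAt.comp (f := fun z => ((-(c⁻¹ * e z) : Circle) : ℂ))
      (Complex.continuousAt_arg (hslit z)) (by fun_prop)
  have hθi : Function.Injective θ := fun z w h => by
    have := Circle.injective_arg h
    simpa [hi.eq_iff] using this
  let q : ℝ → ℝ := fun t => θ (Circle.exp t) - θ (-Circle.exp t)
  have hq : Continuous q := by fun_prop
  have hq' : q Real.pi = -q 0 := by simp [q, circle_exp_pi]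
  obtain ⟨t, ht⟩ : (0 : ℝ) ∈ range q := by
    rcases le_total (q 0) 0 with h | h
    · exact mem_range_of_exists_le_of_exists_ge hq ⟨0, h⟩ ⟨Real.pi, by linarith⟩
    · exact mem_range_of_exists_le_of_exists_ge hq ⟨Real.pi, by linarith⟩ ⟨0, h⟩
  have := congrArg Subtype.val (hθi (sub_eq_zero.1 ht))
  rw [Circle.coe_neg, self_eq_neg] at this
  exact Circle.coe_ne_zero _ this

theorem IsJordanCurve.range_eq_of_injective {Γ : Set ℂ} (hΓ : IsJordanCurve Γ) {e : Circle → ℂ}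
    (he : Continuous e) (hi : Function.Injective e) (h : ∀ ζ, e ζ ∈ Γ) : range e = Γ := by
  obtain ⟨γ, hγ, hγi, rfl⟩ := hΓ
  have hemb := (hγ.isClosedEmbedding hγi).isEmbedding
  choose k hk using h
  have hkc : Continuous k := by
    rw [hemb.continuous_iff]
    convert he using 1
    exact funext hk
  have hki : Function.Injective k := fun x y hxy => hi (by rw [← hk, ← hk, hxy])
  refine Subset.antisymm (range_subset_iff.2 fun ζ => ⟨k ζ, hk ζ⟩) ?_
  rintro _ ⟨c, rfl⟩
  obtain ⟨ζ, rfl⟩ := surjective_of_continuous_of_injective hkc hki c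
  exact ⟨ζ, (hk ζ).symm⟩

/-! ### Images of closed sets under proper maps -/

section Proper

variable {C : Set ℂ} {E : ℂ → ℂ}

/-- For bounded C the filter `cobounded ⊓ 𝓟 C` is `⊥` and the hypothesis is empty, so the closed
disk and the closed exterior are treated alike. -/
theorem isProperMap_domRestrict (hC : IsClosed C) (hE : ContinuousOn E C)
    (ht : Tendsto E (Bornology.cobounded ℂ ⊓ 𝓟 C) (Bornology.cobounded ℂ)) :
    IsProperMap (C.domRestrict E) := by
  rw [isProperMap_iff_tendsto_cocompact]
  refine ⟨hE.domRestrict, ?_⟩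
  rw [Metric.cobounded_eq_cocompact] at ht
  refine ht.comp (tendsto_inf.2 ⟨hC.isClosedEmbedding_subtypeVal.tendsto_cocompact, ?_⟩)
  exact tendsto_principal.2 (Eventually.of_forall fun x => x.2)

theorem isClosed_image_of_tendsto (hC : IsClosed C) (hE : ContinuousOn E C)
    (ht : Tendsto E (Bornology.cobounded ℂ ⊓ 𝓟 C) (Bornology.cobounded ℂ)) :
    IsClosed (E '' C) := by
  rw [← range_domRestrict]
  exact (isProperMap_domRestrict hC hE ht).isClosedMap.isClosed_range

theorem closure_image_eq_of_tendsto {U : Set ℂ} (hE : ContinuousOn E (closure U))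
    (ht : Tendsto E (Bornology.cobounded ℂ ⊓ 𝓟 (closure U)) (Bornology.cobounded ℂ)) :
    closure (E '' U) = E '' closure U :=
  Subset.antisymm (closure_minimal (image_mono subset_closure)
    (isClosed_image_of_tendsto isClosed_closure hE ht)) hE.image_closure

theorem continuousOn_invFunOn_of_tendsto (hC : IsClosed C) (hE : ContinuousOn E C)
    (hi : InjOn E C)
    (ht : Tendsto E (Bornology.cobounded ℂ ⊓ 𝓟 C) (Bornology.cobounded ℂ)) :
    ContinuousOn (Function.invFunOn E C) (E '' C) := by
  have hemb : IsClosedEmbedding (C.domRestrict E) := .of_continuous_injective_isClosedMap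
    hE.domRestrict (injOn_iff_injective.1 hi) (isProperMap_domRestrict hC hE ht).isClosedMap
  rw [← range_domRestrict, continuousOn_iff_continuous_domRestrict]
  have : (range (C.domRestrict E)).domRestrict (Function.invFunOn E C) =
      Subtype.val ∘ hemb.isEmbedding.toHomeomorph.symm := by
    funext y
    obtain ⟨x, rfl⟩ := hemb.isEmbedding.toHomeomorph.surjective y
    simp only [Function.comp_apply, Homeomorph.symm_apply_apply, domRestrict_apply]
    exact hi.leftInvOn_invFunOn x.2
  rw [this]
  exact continuous_subtype_val.comp (Homeomorph.continuous _)

/-- Points of C in a fixed ball form a compact set, whose image is bounded. -/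
theorem tendsto_invFunOn_cobounded (hC : IsClosed C) (hE : ContinuousOn E C) :
    Tendsto (Function.invFunOn E C) (Bornology.cobounded ℂ ⊓ 𝓟 (E '' C))
      (Bornology.cobounded ℂ) := by
  refine (Metric.hasBasis_cobounded_compl_closedBall (0 : ℂ)).tendsto_right_iff.2 fun R _ => ?_
  have hb : Bornology.IsBounded (E '' (C ∩ Metric.closedBall 0 R)) :=
    (((isCompact_closedBall 0 R).inter_left hC).image_of_continuousOn
      (hE.mono inter_subset_left)).isBounded
  filter_upwards [mem_inf_of_left (Bornology.isBounded_def.1 hb), mem_inf_of_right (mem_principal_self _)]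
    with w hw hwC hR
  exact hw ⟨_, ⟨Function.invFunOn_mem hwC, hR⟩, Function.invFunOn_eq hwC⟩

end Proper

/-! ### The disk and its exterior -/

theorem disk_eq : disk = Metric.ball (0 : ℂ) 1 := by
  ext z
  simp [disk]

theorem isOpen_disk : IsOpen disk := disk_eq ▸ Metric.isOpen_ball

theorem closure_disk : closure disk = Metric.closedBall (0 : ℂ) 1 := by
  rw [disk_eq, closure_ball _ one_ne_zero]

theorem exteriorDisk_eq : exteriorDisk = (Metric.closedBall (0 : ℂ) 1)ᶜ := by
  ext z
  simp [exteriorDisk]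

theorem isOpen_exteriorDisk : IsOpen exteriorDisk :=
  exteriorDisk_eq ▸ Metric.isClosed_closedBall.isOpen_compl

theorem closure_exteriorDisk : closure exteriorDisk = {z : ℂ | 1 ≤ ‖z‖} := by
  rw [exteriorDisk_eq, closure_compl, interior_closedBall _ one_ne_zero]
  ext z
  simp

theorem exteriorDisk_mem_cobounded : exteriorDisk ∈ Bornology.cobounded ℂ := by
  rw [exteriorDisk_eq]
  exact Bornology.isBounded_def.1 Metric.isBounded_closedBall

/-! ### The complementary components -/

section Components

variable {Γ : Set ℂ}

theorem isOpen_inside (hΓ : IsClosed Γ) : IsOpen (inside Γ) := by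
  rw [isOpen_iff_mem_nhds]
  rintro z ⟨hz, hb⟩
  filter_upwards [hΓ.isOpen_compl.connectedComponentIn.mem_nhds (mem_connectedComponentIn hz)]
    with w hw
  exact ⟨connectedComponentIn_subset _ _ hw, connectedComponentIn_eq hw ▸ hb⟩

theorem isOpen_outside (hΓ : IsClosed Γ) : IsOpen (outside Γ) := by
  rw [isOpen_iff_mem_nhds]
  rintro z ⟨hz, hb⟩
  filter_upwards [hΓ.isOpen_compl.connectedComponentIn.mem_nhds (mem_connectedComponentIn hz)]
    with w hw
  exact ⟨connectedComponentIn_subset _ _ hw, connectedComponentIn_eq hw ▸ hb⟩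

theorem disjoint_inside_outside : Disjoint (inside Γ) (outside Γ) :=
  Set.disjoint_left.2 fun _ h h' => h'.2 h.2

/-- A point off Γ lies in one of two disjoint open sets, hence not in the closure of the other. The
Jordan curve theorem is not needed. -/
theorem mem_of_mem_closure_inside_of_mem_closure_outside (hΓ : IsClosed Γ) {p : ℂ}
    (h₁ : p ∈ closure (inside Γ)) (h₂ : p ∈ closure (outside Γ)) : p ∈ Γ := by
  by_contra hp
  by_cases hb : Bornology.IsBounded (connectedComponentIn Γᶜ p)
  · exact (disjoint_inside_outside.closure_right (isOpen_inside hΓ)).le_bot ⟨⟨hp, hb⟩, h₂⟩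
  · exact (disjoint_inside_outside.closure_left (isOpen_outside hΓ)).le_bot ⟨h₁, hp, hb⟩

/-- The conformal maps of a conformal welding, extended to the boundary. -/
theorem IsConformalWelding.exists_extensions {h : Circle ≃ₜ Circle} (hΓ : IsJordanCurve Γ)
    (hh : IsConformalWelding Γ h) :
    ∃ E D : ℂ → ℂ, DifferentiableOn ℂ E disk ∧ ContinuousOn E (closure disk) ∧
      E '' disk = inside Γ ∧ InjOn E (closure disk) ∧
      DifferentiableOn ℂ D exteriorDisk ∧ ContinuousOn D (closure exteriorDisk) ∧
      D '' exteriorDisk = outside Γ ∧ InjOn D (closure exteriorDisk) ∧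
      Tendsto D (Bornology.cobounded ℂ) (Bornology.cobounded ℂ) ∧
      (∀ ζ : Circle, E ζ = D (h ζ)) ∧ range (fun ζ : Circle => E ζ) = Γ := by
  obtain ⟨F, G, ⟨hF, hFb⟩, ⟨hG, hGb⟩, hGt, hFG⟩ := hh
  have hcl := hΓ.isCompact.isClosed
  let E := extendFrom disk F
  let D := extendFrom exteriorDisk G
  have hEF : EqOn E F disk := extendFrom_extends hF.continuousOn
  have hDG : EqOn D G exteriorDisk := extendFrom_extends hG.continuousOn
  have hlimF : ∀ z ∈ closure disk, ∃ p, Tendsto F (𝓝[disk] z) (𝓝 p) := by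
    intro z hz
    rw [closure_disk, mem_closedBall_zero_iff] at hz
    rcases hz.lt_or_eq with hz | hz
    · exact ⟨_, hF.continuousOn z hz⟩
    · obtain ⟨ζ, rfl⟩ := exists_circle_eq hz
      obtain ⟨p, hp, -⟩ := hFG ζ
      exact ⟨p, hp⟩
  have hlimG : ∀ z ∈ closure exteriorDisk, ∃ p, Tendsto G (𝓝[exteriorDisk] z) (𝓝 p) := by
    intro z hz
    rw [closure_exteriorDisk] at hz
    rcases (show 1 ≤ ‖z‖ from hz).lt_or_eq with hz | hz
    · exact ⟨_, hG.continuousOn z hz⟩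
    · obtain ⟨ζ, rfl⟩ := exists_circle_eq hz.symm
      obtain ⟨p, -, hp⟩ := hFG (h.symm ζ)
      rw [h.apply_symm_apply] at hp
      exact ⟨p, hp⟩
  have hEc : ContinuousOn E (closure disk) := continuousOn_extendFrom le_rfl hlimF
  have hDc : ContinuousOn D (closure exteriorDisk) := continuousOn_extendFrom le_rfl hlimG
  have hmemE : ∀ ζ : Circle, (ζ : ℂ) ∈ closure disk := fun ζ => by
    simp [closure_disk, Circle.norm_coe]
  have hmemD : ∀ ζ : Circle, (ζ : ℂ) ∈ closure exteriorDisk := fun ζ => by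
    simp [closure_exteriorDisk, Circle.norm_coe]
  have hED : ∀ ζ : Circle, E ζ = D (h ζ) := by
    intro ζ
    obtain ⟨p, hp, hp'⟩ := hFG ζ
    exact (extendFrom_eq (hmemE ζ) hp).trans (extendFrom_eq (hmemD _) hp').symm
  have hEb : BijOn E disk (inside Γ) := hFb.congr hEF.symm
  have hDb : BijOn D exteriorDisk (outside Γ) := hGb.congr hDG.symm
  have hEd : DifferentiableOn ℂ E disk := hF.congr hEF
  have hDd : DifferentiableOn ℂ D exteriorDisk := hG.congr hDG
  have hEΓ : ∀ ζ : Circle, E ζ ∈ Γ := by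
    intro ζ
    refine mem_of_mem_closure_inside_of_mem_closure_outside hcl ?_ ?_
    · rw [← hEb.image_eq]
      exact hEc.image_closure (mem_image_of_mem E (hmemE ζ))
    · rw [← hDb.image_eq, hED]
      exact hDc.image_closure (mem_image_of_mem D (hmemD _))
  have hEi : InjOn E (closure disk) := by
    rw [closure_disk]
    rw [closure_disk] at hEc
    rw [disk_eq] at hEd
    refine hΓ.injOn_closedBall hEc hEd (by rw [← disk_eq]; exact hEb.injOn)
      (fun z hz => (hEb.mapsTo hz).1) fun z hz => ?_
    obtain ⟨ζ, rfl⟩ := exists_circle_eq hz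
    exact hEΓ ζ
  have hDΓ : ∀ ζ : Circle, D ζ ∈ Γ := fun ζ => by
    have := hEΓ (h.symm ζ)
    rwa [hED, h.apply_symm_apply] at this
  -- On the circle D = E ∘ h⁻¹ inherits injectivity from E; the exterior is mapped off Γ.
  have hDi : InjOn D (closure exteriorDisk) := by
    intro z hz w hw hzw
    rw [closure_exteriorDisk] at hz hw
    rcases (show 1 ≤ ‖z‖ from hz).lt_or_eq with hz | hz <;>
      rcases (show 1 ≤ ‖w‖ from hw).lt_or_eq with hw | hw
    · exact hDb.injOn hz hw hzw
    · obtain ⟨ω, rfl⟩ := exists_circle_eq hw.symm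
      exact absurd (hzw ▸ hDΓ ω) (hDb.mapsTo hz).1
    · obtain ⟨ζ, rfl⟩ := exists_circle_eq hz.symm
      exact absurd (hzw ▸ hDΓ ζ) (hDb.mapsTo hw).1
    · obtain ⟨z, rfl⟩ := exists_circle_eq hz.symm
      obtain ⟨w, rfl⟩ := exists_circle_eq hw.symm
      have h1 := hEi (hmemE (h.symm z)) (hmemE (h.symm w)) (by
        rw [hED, hED, h.apply_symm_apply, h.apply_symm_apply, hzw])
      rw [h.symm.injective (Subtype.ext h1)]
  refine ⟨E, D, hEd, hEc, hEb.image_eq, hEi, hDd, hDc, hDb.image_eq, hDi, ?_, hED, ?_⟩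
  · refine hGt.congr' ?_
    filter_upwards [exteriorDisk_mem_cobounded] with z hz using (hDG hz).symm
  · exact hΓ.range_eq_of_injective (hEc.comp_continuous continuous_subtype_val hmemE)
      (fun z w hzw => Subtype.ext (hEi (hmemE z) (hmemE w) hzw)) hEΓ

end Components

/-! ### Reflection in the unit circle -/

/-- The conjugate of `k` precomposed with the reflection in the unit circle. -/
noncomputable def reflection (k : ℂ → ℂ) (z : ℂ) : ℂ := starRingEnd ℂ (k (starRingEnd ℂ z)⁻¹)

theorem reflection_apply_circle (k : ℂ → ℂ) (ζ : Circle) :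
    reflection k ζ = starRingEnd ℂ (k ζ) := by
  rw [reflection, ← map_inv₀, ← Circle.coe_inv, ← Circle.coe_inv_eq_conj, inv_inv]

theorem differentiableAt_reflection {k : ℂ → ℂ} {z : ℂ} (hz : z ≠ 0)
    (hk : DifferentiableAt ℂ k (starRingEnd ℂ z)⁻¹) : DifferentiableAt ℂ (reflection k) z := by
  have : DifferentiableAt ℂ (k ∘ fun w => w⁻¹) (starRingEnd ℂ z) :=
    hk.comp _ (differentiableAt_inv (by simpa using hz))
  exact differentiableAt_conj_conj_iff.2 this

theorem continuousOn_reflection {k : ℂ → ℂ} {S T : Set ℂ} (hk : ContinuousOn k T)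
    (hS : ∀ z ∈ S, z ≠ 0) (hST : ∀ z ∈ S, (starRingEnd ℂ z)⁻¹ ∈ T) :
    ContinuousOn (reflection k) S :=
  Complex.continuous_conj.comp_continuousOn
    (hk.comp (Complex.continuous_conj.continuousOn.inv₀ fun z hz => by simpa using hS z hz) hST)

theorem tendsto_conj_inv_cobounded :
    Tendsto (fun z : ℂ => (starRingEnd ℂ z)⁻¹) (Bornology.cobounded ℂ) (𝓝 0) := by
  rw [tendsto_zero_iff_norm_tendsto_zero]
  simpa [Function.comp_def] using tendsto_inv_atTop_zero.comp (tendsto_norm_cobounded_atTop (E := ℂ))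

theorem tendsto_conj_inv_zero :
    Tendsto (fun z : ℂ => (starRingEnd ℂ z)⁻¹) (𝓝[≠] 0) (Bornology.cobounded ℂ) := by
  rw [← tendsto_norm_atTop_iff_cobounded]
  simpa [Function.comp_def] using tendsto_inv_nhdsGT_zero.comp (tendsto_norm_nhdsNE_zero (E := ℂ))

theorem norm_conj_inv (z : ℂ) : ‖(starRingEnd ℂ z)⁻¹‖ = ‖z‖⁻¹ := by simp

theorem conj_inv_conj_inv (z : ℂ) :
    (starRingEnd ℂ (starRingEnd ℂ z)⁻¹)⁻¹ = z := by simp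

theorem memAInfty_reflection {ψ : ℂ → ℂ} (hψ : MemA disk ψ) (h0 : ψ 0 = 0) :
    MemAInfty exteriorDisk (reflection ψ) := by
  refine ⟨⟨fun z hz => ?_, ?_⟩, ?_⟩
  · have hz' : 1 < ‖z‖ := hz
    have hmem : (starRingEnd ℂ z)⁻¹ ∈ disk := by
      simpa [disk] using inv_lt_one_of_one_lt₀ hz'
    exact (differentiableAt_reflection (norm_pos_iff.1 (zero_lt_one.trans hz'))
      (hψ.1.differentiableAt (isOpen_disk.mem_nhds hmem))).differentiableWithinAt
  · rw [closure_exteriorDisk]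
    refine continuousOn_reflection hψ.2 (fun z hz => ?_) fun z hz => ?_
    · exact norm_pos_iff.1 (zero_lt_one.trans_le hz)
    · rw [closure_disk, mem_closedBall_zero_iff, norm_conj_inv]
      exact inv_le_one_of_one_le₀ hz
  · have h1 : ContinuousAt ψ 0 := (hψ.1.differentiableAt
      (isOpen_disk.mem_nhds (by simp [disk]))).continuousAt
    have h2 : Tendsto ψ (𝓝 0) (𝓝 0) := by simpa only [ContinuousAt, h0] using h1
    have := (Complex.continuous_conj.tendsto 0).comp (h2.comp tendsto_conj_inv_cobounded)
    rwa [map_zero] at this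

/-- At 0 the formula gives the irrelevant value conj (k 0), as 0⁻¹ = 0. The limit 0 of k at ∞ is the
right value and makes the singularity removable. -/
theorem memA_update_reflection {k : ℂ → ℂ} (hk : MemAInfty exteriorDisk k) :
    MemA disk (Function.update (reflection k) 0 0) := by
  obtain ⟨⟨hd, hc⟩, ht⟩ := hk
  have hne : ∀ z : ℂ, z ≠ 0 → Function.update (reflection k) 0 0 =ᶠ[𝓝 z] reflection k := by
    intro z hz
    filter_upwards [isOpen_ne.mem_nhds hz] with w hw using Function.update_of_ne hw _ _
  have hcont0 : ContinuousAt (Function.update (reflection k) 0 0) 0 := by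
    rw [continuousAt_update_same]
    have := (Complex.continuous_conj.tendsto 0).comp (ht.comp tendsto_conj_inv_zero)
    rwa [map_zero] at this
  constructor
  · rw [← Complex.differentiableOn_compl_singleton_and_continuousAt_iff (c := 0)
      (isOpen_disk.mem_nhds (by simp [disk]))]
    refine ⟨fun z hz => ?_, hcont0⟩
    have hz0 : z ≠ 0 := hz.2
    have hmem : (starRingEnd ℂ z)⁻¹ ∈ exteriorDisk := by
      change 1 < ‖(starRingEnd ℂ z)⁻¹‖
      rw [norm_conj_inv]
      exact (one_lt_inv₀ (norm_pos_iff.2 hz0)).2 hz.1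
    exact (((differentiableAt_reflection hz0 (hd.differentiableAt
      (isOpen_exteriorDisk.mem_nhds hmem))).congr_of_eventuallyEq
        (hne z hz0))).differentiableWithinAt
  · have hc' : ContinuousOn (reflection k) (closure disk \ {0}) := by
      refine continuousOn_reflection hc (fun z hz => hz.2) fun z hz => ?_
      have hz1 := hz.1
      rw [closure_disk, mem_closedBall_zero_iff] at hz1
      rw [closure_exteriorDisk]
      change 1 ≤ ‖(starRingEnd ℂ z)⁻¹‖
      rw [norm_conj_inv]
      exact (one_le_inv₀ (norm_pos_iff.2 hz.2)).2 hz1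
    intro z hz
    by_cases hz0 : z = 0
    · rw [hz0]
      exact hcont0.continuousWithinAt
    · have h1 := hc' z ⟨hz, hz0⟩
      rw [Set.sdiff_eq, inter_comm, ContinuousWithinAt, nhdsWithin_inter_of_mem
        (nhdsWithin_le_nhds (isOpen_compl_singleton.mem_nhds hz0))] at h1
      exact ContinuousWithinAt.congr_of_eventuallyEq h1 (nhdsWithin_le_nhds (hne z hz0))
        (hne z hz0).self_of_nhds

end Matching

namespace Matching

/-! ### Transfer between matching pairs and pairs in the disk algebra -/

theorem tendsto_cobounded_inf_principal_closure_disk (E : ℂ → ℂ) :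
    Tendsto E (Bornology.cobounded ℂ ⊓ 𝓟 (closure disk)) (Bornology.cobounded ℂ) := by
  have : Bornology.cobounded ℂ ⊓ 𝓟 (closure disk) = ⊥ := by
    rw [inf_principal_eq_bot, closure_disk]
    exact Bornology.isBounded_def.1 Metric.isBounded_closedBall
  rw [this]
  exact tendsto_bot

section Transfer

variable {U : Set ℂ} {E f : ℂ → ℂ}

theorem MemA.comp (hE : DifferentiableOn ℂ E U) (hEc : ContinuousOn E (closure U))
    (hf : MemA (E '' U) f) : MemA U (f ∘ E) :=
  ⟨hf.1.comp hE (mapsTo_image E U),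
    hf.2.comp hEc fun _ hz => hEc.image_closure (mem_image_of_mem E hz)⟩

theorem MemA.comp_invFunOn (hU : IsOpen U) (hE : DifferentiableOn ℂ E U)
    (hEc : ContinuousOn E (closure U)) (hi : InjOn E (closure U))
    (ht : Tendsto E (Bornology.cobounded ℂ ⊓ 𝓟 (closure U)) (Bornology.cobounded ℂ))
    (hf : MemA U f) : MemA (E '' U) (f ∘ Function.invFunOn E (closure U)) := by
  have hleft : LeftInvOn (Function.invFunOn E (closure U)) E (closure U) :=
    hi.leftInvOn_invFunOn
  constructor
  · refine hf.1.comp (differentiableOn_of_leftInvOn hU hE (hleft.mono subset_closure)) ?_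
    rintro _ ⟨z, hz, rfl⟩
    rwa [hleft (subset_closure hz)]
  · rw [closure_image_eq_of_tendsto hEc ht]
    exact hf.2.comp (continuousOn_invFunOn_of_tendsto isClosed_closure hEc hi ht)
      fun w hw => Function.invFunOn_mem hw

theorem MemA.congr {g : ℂ → ℂ} (hf : MemA U f) (h : EqOn g f (closure U)) : MemA U g :=
  ⟨hf.1.congr (h.mono subset_closure), hf.2.congr h⟩

end Transfer

theorem exists_pair_of_isMatchingPair {Γ : Set ℂ} {h : Circle ≃ₜ Circle} (hΓ : IsJordanCurve Γ)
    (hh : IsConformalWelding Γ h) {f g : ℂ → ℂ} (hfg : IsMatchingPair Γ f g) :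
    ∃ φ ψ : ℂ → ℂ, MemA disk φ ∧ MemA disk ψ ∧ NonconstantOn φ (closure disk) ∧
      NonconstantOn ψ (closure disk) ∧ ∀ ζ : Circle, φ ζ = ψ (h ζ) := by
  obtain ⟨E, D, hE, hEc, hEim, -, hD, hDc, hDim, -, hDt, hED, hEΓ⟩ := hh.exists_extensions hΓ
  obtain ⟨hf, ⟨hg, hgt⟩, hfn, hgn, hmatch⟩ := hfg
  rw [← hEim] at hf hfn
  rw [← hDim] at hg hgn
  have hcD : closure (D '' exteriorDisk) = D '' closure exteriorDisk :=
    closure_image_eq_of_tendsto hDc (hDt.mono_left inf_le_left)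
  have hcE : closure (E '' disk) = E '' closure disk :=
    closure_image_eq_of_tendsto hEc (tendsto_cobounded_inf_principal_closure_disk E)
  refine ⟨f ∘ E, Function.update (reflection (g ∘ D)) 0 0, hf.comp hE hEc,
    memA_update_reflection ⟨hg.comp hD hDc, hgt.comp hDt⟩, ?_, ?_, fun ζ => ?_⟩
  · rw [hcE] at hfn
    obtain ⟨_, ⟨x, hx, rfl⟩, _, ⟨y, hy, rfl⟩, hxy⟩ := hfn
    exact ⟨x, hx, y, hy, hxy⟩
  · rw [hcD] at hgn
    obtain ⟨_, ⟨x, hx, rfl⟩, _, ⟨y, hy, rfl⟩, hxy⟩ := hgn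
    have key : ∀ z ∈ closure exteriorDisk, (starRingEnd ℂ z)⁻¹ ∈ closure disk ∧
        Function.update (reflection (g ∘ D)) 0 0 (starRingEnd ℂ z)⁻¹ =
          starRingEnd ℂ (g (D z)) := by
      intro z hz
      rw [closure_exteriorDisk] at hz
      have hz0 : z ≠ 0 := norm_pos_iff.1 (zero_lt_one.trans_le hz)
      refine ⟨?_, ?_⟩
      · rw [closure_disk, mem_closedBall_zero_iff, norm_conj_inv]
        exact inv_le_one_of_one_le₀ hz
      · rw [Function.update_of_ne (by simpa using hz0), reflection, conj_inv_conj_inv]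
        rfl
    refine ⟨_, (key x hx).1, _, (key y hy).1, ?_⟩
    rw [(key x hx).2, (key y hy).2]
    exact fun heq => hxy ((starRingEnd ℂ).injective heq)
  · rw [Function.update_of_ne (Circle.coe_ne_zero _), reflection_apply_circle]
    change f (E ζ) = starRingEnd ℂ (g (D (h ζ)))
    rw [hmatch (E ζ) (hEΓ ▸ mem_range_self ζ), hED]

theorem exists_isMatchingPair_of_pair {Γ : Set ℂ} {h : Circle ≃ₜ Circle} (hΓ : IsJordanCurve Γ)
    (hh : IsConformalWelding Γ h) {φ ψ : ℂ → ℂ} (hφ : MemA disk φ) (hψ : MemA disk ψ)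
    (hφn : NonconstantOn φ (closure disk)) (hψn : NonconstantOn ψ (closure disk))
    (hψ0 : ψ 0 = 0) (hφψ : ∀ ζ : Circle, φ ζ = ψ (h ζ)) : MPSolvable Γ := by
  obtain ⟨E, D, hE, hEc, hEim, hEi, hD, hDc, hDim, hDi, hDt, hED, hEΓ⟩ := hh.exists_extensions hΓ
  have hDt' := hDt.mono_left (inf_le_left (b := 𝓟 (closure exteriorDisk)))
  have hEt := tendsto_cobounded_inf_principal_closure_disk E
  have hcE := closure_image_eq_of_tendsto hEc hEt
  have hcD := closure_image_eq_of_tendsto hDc hDt'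
  have hEl : LeftInvOn (Function.invFunOn E (closure disk)) E (closure disk) :=
    hEi.leftInvOn_invFunOn
  have hDl : LeftInvOn (Function.invFunOn D (closure exteriorDisk)) D (closure exteriorDisk) :=
    hDi.leftInvOn_invFunOn
  obtain ⟨hk, hkt⟩ := memAInfty_reflection hψ hψ0
  let f : ℂ → ℂ := φ ∘ Function.invFunOn E (closure disk)
  -- Extension by 0 reduces the limit along all of `cobounded ℂ` to the limit within the closed
  -- image of D.
  let g : ℂ → ℂ := (D '' closure exteriorDisk).indicator
    (reflection ψ ∘ Function.invFunOn D (closure exteriorDisk))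
  have hf : ∀ z ∈ closure disk, f (E z) = φ z := fun z hz => congrArg φ (hEl hz)
  have hg : ∀ z ∈ closure exteriorDisk, g (D z) = reflection ψ z := fun z hz =>
    (indicator_of_mem (mem_image_of_mem D hz) _).trans (congrArg (reflection ψ) (hDl hz))
  refine ⟨f, g, ?_, ⟨?_, ?_⟩, ?_, ?_, ?_⟩
  · rw [← hEim]
    exact hφ.comp_invFunOn isOpen_disk hE hEc hEi hEt
  · rw [← hDim]
    refine (hk.comp_invFunOn isOpen_exteriorDisk hD hDc hDi hDt').congr ?_
    rw [hcD]
    exact eqOn_indicator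
  · have h1 := hkt.comp (tendsto_invFunOn_cobounded isClosed_closure hDc)
    rw [tendsto_def] at h1 ⊢
    intro s hs
    filter_upwards [mem_inf_principal.1 (h1 s hs)] with w hw
    by_cases hwD : w ∈ D '' closure exteriorDisk
    · simpa only [mem_preimage, g, indicator_of_mem hwD] using hw hwD
    · simpa only [mem_preimage, g, indicator_of_notMem hwD] using mem_of_mem_nhds hs
  · rw [← hEim, hcE]
    obtain ⟨x, hx, y, hy, hxy⟩ := hφn
    exact ⟨_, mem_image_of_mem E hx, _, mem_image_of_mem E hy, by rwa [hf x hx, hf y hy]⟩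
  · rw [← hDim, hcD]
    obtain ⟨x, hx, hx0⟩ : ∃ x ∈ closure disk, ψ x ≠ 0 := by
      by_contra! h0
      obtain ⟨x, hx, y, hy, hxy⟩ := hψn
      exact hxy ((h0 x hx).trans (h0 y hy).symm)
    -- The point 0 reflects to ∞, so two different values of ψ are needed at nonzero points; y is
    -- taken near 0 by continuity.
    obtain ⟨y, hy, hy0, hxy⟩ : ∃ y ∈ closure disk, y ≠ 0 ∧ ψ y ≠ ψ x := by
      have h0 : disk ∈ 𝓝 (0 : ℂ) := isOpen_disk.mem_nhds (by simp [disk])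
      have hc : ContinuousAt ψ 0 := (hψ.1.differentiableAt h0).continuousAt
      have h1 : ∀ᶠ y in 𝓝 (0 : ℂ), ψ y ≠ ψ x := hc.eventually_ne (by rw [hψ0]; exact hx0.symm)
      obtain ⟨y, ⟨hy, hyd⟩, hy0⟩ := (((h1.and h0).filter_mono nhdsWithin_le_nhds).and
        (eventually_mem_nhdsWithin (a := (0 : ℂ)) (s := {0}ᶜ))).exists
      exact ⟨y, subset_closure hyd, hy0, hy⟩
    have key : ∀ z ∈ closure disk, z ≠ 0 → (starRingEnd ℂ z)⁻¹ ∈ closure exteriorDisk ∧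
        reflection ψ (starRingEnd ℂ z)⁻¹ = starRingEnd ℂ (ψ z) := by
      intro z hz hz0
      rw [closure_disk, mem_closedBall_zero_iff] at hz
      refine ⟨?_, by rw [reflection, conj_inv_conj_inv]⟩
      rw [closure_exteriorDisk]
      change 1 ≤ ‖(starRingEnd ℂ z)⁻¹‖
      rw [norm_conj_inv]
      exact (one_le_inv₀ (norm_pos_iff.2 hz0)).2 hz
    obtain ⟨hx1, hx2⟩ := key x hx (by rintro rfl; exact hx0 hψ0)
    obtain ⟨hy1, hy2⟩ := key y hy hy0
    refine ⟨_, mem_image_of_mem D hy1, _, mem_image_of_mem D hx1, ?_⟩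
    rw [hg _ hx1, hg _ hy1, hx2, hy2]
    exact fun heq => hxy ((starRingEnd ℂ).injective heq)
  · intro z hz
    rw [← hEΓ] at hz
    obtain ⟨ζ, rfl⟩ := hz
    have h1 : (ζ : ℂ) ∈ closure disk := by simp [closure_disk, Circle.norm_coe]
    have h2 : ((h ζ : Circle) : ℂ) ∈ closure exteriorDisk := by
      simp [closure_exteriorDisk, Circle.norm_coe]
    rw [hf _ h1]
    change φ ζ = starRingEnd ℂ (g (E ζ))
    rw [hED, hg _ h2, reflection_apply_circle, Complex.conj_conj, hφψ]

end Matching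

theorem mainTheorem5 (Γ : Set ℂ) (hΓ : Matching.IsJordanCurve Γ)
    (h : Circle ≃ₜ Circle) (hh : Matching.IsConformalWelding Γ h) :
    Matching.MPSolvable Γ ↔
      ∃ φ ψ : ℂ → ℂ,
        Matching.MemA Matching.disk φ ∧ Matching.MemA Matching.disk ψ ∧
        Matching.NonconstantOn φ (closure Matching.disk) ∧
        Matching.NonconstantOn ψ (closure Matching.disk) ∧
        ∀ ζ : Circle, φ (ζ : ℂ) = ψ ((h ζ : Circle) : ℂ) := by
  constructor
  · rintro ⟨f, g, hfg⟩
    exact Matching.exists_pair_of_isMatchingPair hΓ hh hfg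
  · rintro ⟨φ, ψ, hφ, hψ, ⟨x, hx, y, hy, hxy⟩, ⟨z, hz, w, hw, hzw⟩, hφψ⟩
    -- Subtracting ψ 0 from both functions keeps the welding relation and makes the reflected
    -- function vanish at ∞.
    refine Matching.exists_isMatchingPair_of_pair hΓ hh (φ := fun u => φ u - ψ 0)
      (ψ := fun u => ψ u - ψ 0) ⟨hφ.1.sub_const _, hφ.2.sub continuousOn_const⟩
      ⟨hψ.1.sub_const _, hψ.2.sub continuousOn_const⟩ ⟨x, hx, y, hy, ?_⟩ ⟨z, hz, w, hw, ?_⟩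
      (sub_self _) fun ζ => by rw [hφψ]
    · exact fun heq => hxy (sub_left_injective heq)
    · exact fun heq => hzw (sub_left_injective heq)
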